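/- Let $d\ge 1$ be an integer, let $\mathbb T=\mathbb R/\mathbb Z$, and let $\alpha\in\mathbb R$ be irrational. For $x\in\mathbb R$ let $\|x\|_{\mathbb R/\mathbb Z}$ denote the distance from $x$ to the nearest integer, and for $\tau\ge 0$ let $$DC(\tau)=\bigcup_{c>0}\Big\{x\in\mathbb R:\ \|hx\|_{\mathbb R/\mathbb Z}\ge \frac{c}{|h|^{\tau}}\ \text{ for all } h\in\mathbb Z\setminus\{0\}\Big\}.$$ Let $f:\mathbb T^d\to\mathbb T^d$ be the skew-shift $$f(y_1,y_2,\dots,y_d)=(y_1+\alpha,\;y_2+y_1,\;\dots,\;y_d+y_{d-1}).$$ The discrepancy of points $x_1,\dots,x_N\in\mathbb T^d$ is $$D_N(x_1,\dots,x_N)=\sup_{C}\left|\frac{\#\{1\le n\le N:\ x_n\in C\}}{N}-m(C)\right|,$$ where $m$ is the normalized Haar (Lebesgue) measure on $\mathbb T^d$ and $C$ runs over the intervals of $\mathbb T^d$, that is, the images in $\mathbb T^d$ of the boxes $\prod_{i=1}^d[\beta_i,\kappa_i)\subset\mathbb R^d$. For $\delta>0$, the map $f$ is said to have weakly $\delta$-bounded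 discrepancy if there is a strictly increasing sequence of positive integers $N_j$ with $D_{N_j}(\theta,f\theta,\dots,f^{N_j-1}\theta)\le N_j^{-\delta}$ for all $j$ and all $\theta\in\mathbb T^d$. If $\alpha\notin DC(d)$, then there exist $\delta>0$ and a strictly increasing sequence $(N_j)$, which is a subsequence of the sequence of denominators of the continued-fraction convergents of $\alpha$, such that $$D_{N_j}\big(f(y),f^2(y),\dots,f^{N_j}(y)\big)\le N_j^{-\delta}\qquad\text{for all } j \text{ and all } y\in\mathbb T^d.$$ In particular, $f$ has weakly $\delta$-bounded discrepancy. -/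

import Mathlib

open MeasureTheory

noncomputable section

/-- The torus `𝕋^d = (ℝ/ℤ)^d`; its `volume` is the product of the normalized Haar measures. -/
abbrev Torus (d : ℕ) : Type := Fin d → UnitAddCircle

/-- The (one-frequency) Diophantine class `DC(τ)`: there is `c > 0` such that
`‖hα‖_{ℝ/ℤ} ≥ c / |h|^τ` for all integers `h ≠ 0`. The norm on `ℝ/ℤ` is the distance to the
nearest integer. -/
def DC (τ : ℝ) : Set ℝ :=
  {α | ∃ c : ℝ, 0 < c ∧ ∀ h : ℤ, h ≠ 0 →
    c / |(h : ℝ)| ^ τ ≤ ‖(((h : ℝ) * α : ℝ) : UnitAddCircle)‖}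

/-- The skew-shift `f(y₁, …, y_d) = (y₁ + α, y₂ + y₁, …, y_d + y_{d-1})` on `𝕋^d`
(the coordinates are indexed from `0` here). -/
def skewShift (d : ℕ) (α : ℝ) (y : Torus d) : Torus d := fun i =>
  if i.val = 0 then y i + (α : UnitAddCircle)
  else y i + y ⟨i.val - 1, lt_of_le_of_lt (Nat.sub_le _ _) i.isLt⟩

/-- The interval `{θ ∈ 𝕋^d : βᵢ ≤ θᵢ < κᵢ for all i}`, i.e. the image in `𝕋^d` of the box
`∏ᵢ [βᵢ, κᵢ) ⊆ ℝ^d`. -/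
def torusInterval {d : ℕ} (β κ : Fin d → ℝ) : Set (Torus d) :=
  {θ | ∀ i, ∃ t ∈ Set.Ico (β i) (κ i), (t : UnitAddCircle) = θ i}

/-- The family of all intervals of `𝕋^d`. -/
def torusIntervals (d : ℕ) : Set (Set (Torus d)) :=
  {C | ∃ β κ : Fin d → ℝ, C = torusInterval β κ}

/-- The counting function `A(C; x₁, …, x_N)`: the number of indices `n` with `x_n ∈ C`. -/
def countIn {d N : ℕ} (C : Set (Torus d)) (x : Fin N → Torus d) : ℝ :=
  ∑ n : Fin N, C.indicator (fun _ => (1 : ℝ)) (x n)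

/-- The discrepancy `D_N(x₁, …, x_N) = sup_C |A(C; x₁, …, x_N) / N - m(C)|`, over all intervals
`C` of `𝕋^d`, where `m` is Lebesgue (Haar) measure. All the numbers are in `[0, 1]`, so that this
is a genuine supremum. -/
def discrepancy {d N : ℕ} (x : Fin N → Torus d) : ℝ :=
  ⨆ C : torusIntervals d, |countIn C.1 x / (N : ℝ) - (volume C.1).toReal|

/-- `f` has weakly `δ`-bounded discrepancy: along some sequence `N_j → ∞` the discrepancy of
`θ, f θ, …, f^{N_j - 1} θ` is at most `N_j^{-δ}`, for all `θ`. -/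
def WeaklyBoundedDiscrepancy {d : ℕ} (δ : ℝ) (f : Torus d → Torus d) : Prop :=
  ∃ N : ℕ → ℕ, StrictMono N ∧ ∀ (j : ℕ) (θ : Torus d),
    discrepancy (fun n : Fin (N j) => f^[n.val] θ) ≤ (N j : ℝ) ^ (-δ)

end

/-! Let `q` be the denominator of a convergent `p / q` of `α`. Over exactly `q` terms, the
exponential sums along an orbit of the skew-shift have a power saving in `q`, uniformly in the
starting point, and Fourier analysis turns this into a power saving for the discrepancy. The
exponent depends only on `d`, and every sufficiently large convergent denominator is admissible.

The saving comes from Weyl differencing. A nontrivial character along an orbit is a polynomial phase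
of degree at most `d` whose top difference is an integer multiple of `α`
(`exists_isPolyPhase_sum_zsmul_skewShift`). Van der Corput's inequality
(`norm_sum_range_le_of_correlation_le`) lowers the degree one step at a time, multiplying the top
coefficient by small integers. In degree one the sum is geometric: `q • α` is within `1 / q` of `0`,
while `a • α` stays at distance at least `1 / (2q)` from `0` for `0 < |a| ≤ q / 2`. Climbing back
gives `IsPolyPhase.norm_sum_le`.

For the passage to boxes, each arc gets a trigonometric majorant built from the Fejér kernel
(`hasTrigMajorant_circleArc`), and products of majorants bound visits to boxes from above
(`sum_prod_indicator_le`). Lower bounds need no minorants: complements of arcs are arcs, so upper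
bounds for all `2 ^ d` boxes of a partition force a lower bound for each
(`abs_sum_prod_indicator_sub_le`). -/

namespace GenContFract

/-! ### Convergents of continued fractions. -/

theorem not_terminatedAt_of_irrational {α : ℝ} (h : Irrational α) (n : ℕ) :
    ¬ (GenContFract.of α).TerminatedAt n := by
  intro hn
  obtain ⟨q, hq⟩ := GenContFract.exists_rat_eq_of_terminates (v := α) ⟨n, hn⟩
  exact h ⟨q, hq.symm⟩

theorem exists_int_nums_dens (α : ℝ) (n : ℕ) :
    ∃ a b : ℤ, (GenContFract.of α).nums n = a ∧ (GenContFract.of α).dens n = b := by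
  -- The recurrence has depth two, so integrality is carried for two consecutive terms.
  suffices H : ∀ n, (∃ a b : ℤ, (GenContFract.of α).contsAux n = ⟨(a : ℝ), (b : ℝ)⟩) ∧
      ∃ a b : ℤ, (GenContFract.of α).contsAux (n + 1) = ⟨(a : ℝ), (b : ℝ)⟩ by
    obtain ⟨a, b, h⟩ := (H n).2
    exact ⟨a, b, by rw [num_eq_conts_a, nth_cont_eq_succ_nth_contAux, h],
      by rw [den_eq_conts_b, nth_cont_eq_succ_nth_contAux, h]⟩
  intro n
  induction n with
  | zero =>
    refine ⟨⟨1, 0, by simp [contsAux]⟩, ⌊α⌋, 1, ?_⟩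
    simp [contsAux, GenContFract.of_h_eq_floor]
  | succ n ih =>
    refine ⟨ih.2, ?_⟩
    obtain ⟨⟨a, b, hab⟩, a', b', hab'⟩ := ih
    rcases hs : (GenContFract.of α).s.get? n with _ | gp
    · refine ⟨a', b', ?_⟩
      rw [contsAux_stable_step_of_terminated hs, hab']
    · obtain ⟨h1, z, hz⟩ := of_partNum_eq_one_and_exists_int_partDen_eq hs
      refine ⟨z * a' + a, z * b' + b, ?_⟩
      rw [contsAux_recurrence hs hab hab', h1, hz]
      simp

/-- The denominators of the convergents of an irrational number, from index `1` on, form a strictly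
increasing sequence of positive integers, with the usual quality of approximation. -/
theorem exists_strictMono_dens {α : ℝ} (hα : Irrational α) :
    ∃ q : ℕ → ℕ, StrictMono q ∧ ∀ k, (q k : ℝ) = (GenContFract.of α).dens (k + 1) ∧ 0 < q k ∧
      ∃ p : ℤ, IsCoprime p (q k : ℤ) ∧ |α - p / q k| ≤ 1 / (q k : ℝ) ^ 2 := by
  have hT := not_terminatedAt_of_irrational hα
  choose a b ha hb using exists_int_nums_dens α
  have hfib : ∀ n, (Nat.fib (n + 1) : ℝ) ≤ (GenContFract.of α).dens n := fun n =>
    succ_nth_fib_le_of_nth_den (Or.inr (hT _))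
  have hbpos : ∀ n, 0 < b n := by
    intro n
    have h := hfib n
    rw [hb] at h
    have h2 : 0 < Nat.fib (n + 1) := Nat.fib_pos.2 n.succ_pos
    have h3 : ((Nat.fib (n + 1) : ℤ) : ℝ) ≤ b n := by exact_mod_cast h
    have h4 : (Nat.fib (n + 1) : ℤ) ≤ b n := by exact_mod_cast h3
    omega
  have hdet : ∀ n, a n * b (n + 1) - b n * a (n + 1) = (-1) ^ (n + 1) := by
    intro n
    have := SimpContFract.determinant (s := SimpContFract.of α) (n := n) (hT n)
    change (GenContFract.of α).nums n * (GenContFract.of α).dens (n + 1) -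
      (GenContFract.of α).dens n * (GenContFract.of α).nums (n + 1) = _ at this
    rw [ha, ha, hb, hb] at this
    exact_mod_cast this
  have hcop : ∀ n, IsCoprime (a n) (b n) := by
    intro n
    have h := hdet n
    rcases Nat.even_or_odd (n + 1) with he | ho
    · rw [he.neg_one_pow] at h
      exact ⟨b (n + 1), -a (n + 1), by linarith⟩
    · rw [ho.neg_one_pow] at h
      exact ⟨-b (n + 1), a (n + 1), by linarith⟩
  have hmono : ∀ n, b (n + 1) < b (n + 2) := by
    intro n
    obtain ⟨gp, hs⟩ := Option.ne_none_iff_exists'.1 (hT (n + 1))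
    obtain ⟨h1, z, hz⟩ := of_partNum_eq_one_and_exists_int_partDen_eq hs
    have hz1 : 1 ≤ gp.b := of_one_le_get?_partDen (partDen_eq_s_b hs)
    have hrec := dens_recurrence hs (hb n) (hb (n + 1))
    rw [hb, h1, hz] at hrec
    rw [hz] at hz1
    have hz2 : 1 ≤ z := by exact_mod_cast hz1
    have h3 : b (n + 2) = z * b (n + 1) + b n := by
      have : (b (n + 2) : ℝ) = z * b (n + 1) + 1 * b n := by exact_mod_cast hrec
      rw [one_mul] at this
      exact_mod_cast this
    nlinarith [hbpos n, hbpos (n + 1)]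
  have hcast : ∀ n, ((b n).toNat : ℤ) = b n := fun n => Int.toNat_of_nonneg (hbpos n).le
  -- The shift by one is needed for strict growth: the denominators of index `0` and `1` can both
  -- equal `1`.
  refine ⟨fun k => (b (k + 1)).toNat, strictMono_nat_of_lt_succ fun k => ?_, fun k => ?_⟩
  · have := hmono k
    have h1 := hcast (k + 1)
    have h2 := hcast (k + 2)
    show (b (k + 1)).toNat < (b (k + 2)).toNat
    omega
  · have hc : (((b (k + 1)).toNat : ℕ) : ℝ) = b (k + 1) := by exact_mod_cast hcast (k + 1)
    have hp := hbpos (k + 1)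
    refine ⟨by rw [hb]; exact hc, by simpa using hp, a (k + 1), ?_, ?_⟩
    · show IsCoprime (a (k + 1)) (((b (k + 1)).toNat : ℕ) : ℤ)
      rw [hcast]; exact hcop _
    · show |α - a (k + 1) / (((b (k + 1)).toNat : ℕ) : ℝ)| ≤ 1 / (((b (k + 1)).toNat : ℕ) : ℝ) ^ 2
      rw [hc]
      have := abs_sub_convs_le (hT (k + 1))
      rw [conv_eq_num_div_den, ha, hb, hb] at this
      refine this.trans ?_
      have hp' : (0 : ℝ) < b (k + 1) := by exact_mod_cast hp
      have hle : (b (k + 1) : ℝ) ≤ b (k + 1 + 1) := by exact_mod_cast (hmono k).le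
      rw [sq]
      gcongr

end GenContFract

/-! ### Characters and geometric sums on the circle. -/

namespace UnitAddCircle

theorem exists_coe_eq_abs_eq_norm (x : UnitAddCircle) :
    ∃ t : ℝ, (t : UnitAddCircle) = x ∧ |t| = ‖x‖ := by
  obtain ⟨s, rfl⟩ := QuotientAddGroup.mk_surjective x
  refine ⟨s - round s, ?_, (UnitAddCircle.norm_eq (x := s)).symm⟩
  have : ((round s : ℝ) : UnitAddCircle) = 0 := by
    rw [AddCircle.coe_eq_zero_iff]
    exact ⟨round s, by simp⟩
  rw [AddCircle.coe_sub, this, sub_zero]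

theorem norm_le_half (x : UnitAddCircle) : ‖x‖ ≤ 1 / 2 := by
  simpa using AddCircle.norm_le_half_period (p := (1 : ℝ)) (x := x) one_ne_zero

theorem coe_toCircle_add (x y : UnitAddCircle) :
    (AddCircle.toCircle (x + y) : ℂ) = AddCircle.toCircle x * AddCircle.toCircle y := by
  rw [AddCircle.toCircle_add, Circle.coe_mul]

theorem norm_toCircle_sub_one {t : ℝ} :
    ‖(AddCircle.toCircle (t : UnitAddCircle) : ℂ) - 1‖ = 2 * |Real.sin (Real.pi * t)| := by
  rw [AddCircle.toCircle_apply_mk, Circle.coe_exp, mul_comm _ Complex.I,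
    Complex.norm_exp_I_mul_ofReal_sub_one, norm_mul, Real.norm_eq_abs, Real.norm_eq_abs, abs_two]
  congr 3
  ring

theorem norm_toCircle_sub_one_le (x : UnitAddCircle) :
    ‖(AddCircle.toCircle x : ℂ) - 1‖ ≤ 2 * Real.pi * ‖x‖ := by
  obtain ⟨t, rfl, ht⟩ := exists_coe_eq_abs_eq_norm x
  rw [norm_toCircle_sub_one, ← ht]
  have := Real.abs_sin_le_abs (x := Real.pi * t)
  rw [abs_mul, abs_of_pos Real.pi_pos] at this
  linarith

/-- Jordan's inequality `sin s ≥ 2 s / π` on `[0, π / 2]`, applied to the representative of absolute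
value at most `1 / 2`. -/
theorem le_norm_toCircle_sub_one (x : UnitAddCircle) :
    4 * ‖x‖ ≤ ‖(AddCircle.toCircle x : ℂ) - 1‖ := by
  obtain ⟨t, rfl, ht⟩ := exists_coe_eq_abs_eq_norm x
  rw [norm_toCircle_sub_one]
  have hle := norm_le_half (t : UnitAddCircle)
  rw [← ht] at hle ⊢
  have h1 : |Real.sin (Real.pi * t)| = Real.sin (Real.pi * |t|) := by
    rcases le_total 0 t with h | h
    · rw [abs_of_nonneg h] at hle ⊢
      exact abs_of_nonneg (Real.sin_nonneg_of_nonneg_of_le_pi (by positivity)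
        (by nlinarith [Real.pi_pos]))
    · rw [abs_of_nonpos h] at hle ⊢
      rw [mul_neg, Real.sin_neg]
      refine abs_of_nonpos (Real.sin_nonpos_of_nonpos_of_neg_pi_le ?_ ?_) <;>
        nlinarith [Real.pi_pos]
  have h2 := Real.mul_le_sin (x := Real.pi * |t|) (by positivity) (by nlinarith [Real.pi_pos])
  have h3 : 2 / Real.pi * (Real.pi * |t|) = 2 * |t| := by
    field_simp
  rw [h1]
  linarith

/-- Bound for a geometric sum of characters. -/
theorem norm_sum_toCircle_nsmul_mul_le (β : UnitAddCircle) (N : ℕ) :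
    ‖∑ n ∈ Finset.range N, (AddCircle.toCircle (n • β) : ℂ)‖ * (4 * ‖β‖) ≤
      2 * Real.pi * ‖N • β‖ := by
  have h : (∑ n ∈ Finset.range N, (AddCircle.toCircle (n • β) : ℂ)) *
      ((AddCircle.toCircle β : ℂ) - 1) = (AddCircle.toCircle (N • β) : ℂ) - 1 := by
    simp_rw [AddCircle.toCircle_nsmul, Circle.coe_pow]
    exact geom_sum_mul _ _
  calc _ ≤ ‖∑ n ∈ Finset.range N, (AddCircle.toCircle (n • β) : ℂ)‖ *
        ‖(AddCircle.toCircle β : ℂ) - 1‖ := by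
        gcongr; exact le_norm_toCircle_sub_one β
    _ = ‖(AddCircle.toCircle (N • β) : ℂ) - 1‖ := by rw [← norm_mul, h]
    _ ≤ _ := norm_toCircle_sub_one_le _

end UnitAddCircle

/-! ### Polynomial phases along orbits of the skew-shift. -/

/-- `u` is a polynomial phase of degree `r` on `ℕ` with values in `ℝ/ℤ`, whose `r`-th difference
with steps `h₁, …, h_r` is the constant `h₁ ⋯ h_r β`. -/
def IsPolyPhase : ℕ → UnitAddCircle → (ℕ → UnitAddCircle) → Prop
  | 0, β, u => ∀ n, u n = β
  | r + 1, β, u => ∀ h : ℕ, IsPolyPhase r (h • β) (fun n => u (n + h) - u n)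

namespace IsPolyPhase

theorem shift {r : ℕ} {β : UnitAddCircle} {u : ℕ → UnitAddCircle} (hu : IsPolyPhase r β u)
    (m : ℕ) : IsPolyPhase r β (fun n => u (n + m)) := by
  induction r generalizing β u with
  | zero => exact fun n => hu _
  | succ r ih =>
    intro h
    have := ih (hu h)
    simpa only [add_right_comm] using this

theorem add {r : ℕ} {β γ : UnitAddCircle} {u v : ℕ → UnitAddCircle} (hu : IsPolyPhase r β u)
    (hv : IsPolyPhase r γ v) : IsPolyPhase r (β + γ) (fun n => u n + v n) := by
  induction r generalizing β γ u v with
  | zero => exact fun n => congrArg₂ (· + ·) (hu n) (hv n)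
  | succ r ih =>
    intro h
    have := ih (hu h) (hv h)
    simp only [smul_add, add_sub_add_comm]
    exact this

theorem zsmul {r : ℕ} {β : UnitAddCircle} {u : ℕ → UnitAddCircle} (hu : IsPolyPhase r β u)
    (k : ℤ) : IsPolyPhase r (k • β) (fun n => k • u n) := by
  induction r generalizing β u with
  | zero => exact fun n => congrArg (k • ·) (hu n)
  | succ r ih =>
    intro h
    have := ih (hu h)
    rw [smul_comm h k β]
    simp only [← smul_sub]
    exact this

theorem zero (r : ℕ) : IsPolyPhase r 0 (fun _ => 0) := by
  induction r with
  | zero => exact fun n => rfl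
  | succ r ih =>
    intro h
    simpa using ih

theorem sum {r : ℕ} {ι : Type*} (s : Finset ι) {β : ι → UnitAddCircle}
    {u : ι → ℕ → UnitAddCircle} (hu : ∀ i ∈ s, IsPolyPhase r (β i) (u i)) :
    IsPolyPhase r (∑ i ∈ s, β i) (fun n => ∑ i ∈ s, u i n) := by
  classical
  induction s using Finset.induction_on with
  | empty => simpa using zero r
  | insert i s hi ih =>
    simp only [Finset.sum_insert hi]
    exact (hu i (Finset.mem_insert_self i s)).add
      (ih fun j hj => hu j (Finset.mem_insert_of_mem hj))

theorem succ_zero {r : ℕ} {β : UnitAddCircle} {u : ℕ → UnitAddCircle} (hu : IsPolyPhase r β u) :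
    IsPolyPhase (r + 1) 0 u := by
  induction r generalizing β u with
  | zero => exact fun h n => by simp [hu n, hu (n + h)]
  | succ r ih =>
    intro h
    rw [smul_zero]
    exact ih (hu h)

theorem zero_of_lt {r s : ℕ} {β : UnitAddCircle} {u : ℕ → UnitAddCircle}
    (hu : IsPolyPhase r β u) (hrs : r < s) : IsPolyPhase s 0 u := by
  induction s, hrs using Nat.le_induction with
  | base => exact hu.succ_zero
  | succ s _ ih => exact ih.succ_zero

/-- A difference with step `h` telescopes into `h` shifted unit differences, so step one decides. -/
theorem of_diff {r : ℕ} {β : UnitAddCircle} {u : ℕ → UnitAddCircle}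
    (hu : IsPolyPhase r β (fun n => u (n + 1) - u n)) : IsPolyPhase (r + 1) β u := by
  intro h
  induction h with
  | zero => simpa using zero r
  | succ h ih =>
    have := ih.add (hu.shift h)
    rw [succ_nsmul]
    convert this using 2 with n
    rw [← add_assoc]
    abel

theorem eq_add_nsmul {β : UnitAddCircle} {u : ℕ → UnitAddCircle} (hu : IsPolyPhase 1 β u)
    (n : ℕ) : u n = u 0 + n • β := by
  have : u (0 + n) - u 0 = n • β := hu n 0
  rw [zero_add] at this
  rw [← this, add_sub_cancel]

end IsPolyPhase

/-- The unit difference in time of a coordinate is the preceding coordinate, and that of coordinate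
`0` is the constant `α`; each coordinate adds one degree. -/
theorem isPolyPhase_skewShift (d : ℕ) (α : ℝ) (y : Torus d) (i : Fin d) :
    IsPolyPhase (i.val + 1) (α : UnitAddCircle) (fun n => (skewShift d α)^[n] y i) := by
  obtain ⟨i, hi⟩ := i
  induction i with
  | zero =>
    refine IsPolyPhase.of_diff fun n => ?_
    beta_reduce
    rw [Function.iterate_succ_apply']
    simp [skewShift]
  | succ i ih =>
    refine IsPolyPhase.of_diff ?_
    have := ih (Nat.lt_of_succ_lt hi)
    convert this using 2 with n
    rw [Function.iterate_succ_apply']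
    simp [skewShift]

theorem exists_isPolyPhase_sum_zsmul_skewShift {d : ℕ} (α : ℝ) (y : Torus d) {k : Fin d → ℤ}
    (hk : k ≠ 0) : ∃ i : Fin d, k i ≠ 0 ∧ IsPolyPhase (i.val + 1) (k i • (α : UnitAddCircle))
      (fun n => ∑ j, k j • (skewShift d α)^[n] y j) := by
  classical
  obtain ⟨i₁, hi₁⟩ := Function.ne_iff.1 hk
  have hne : (Finset.univ.filter fun j => k j ≠ 0).Nonempty := ⟨i₁, by simpa using hi₁⟩
  obtain ⟨i, hi, hmax⟩ := Finset.exists_max_image _ id hne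
  rw [Finset.mem_filter] at hi
  refine ⟨i, hi.2, ?_⟩
  -- `i` is the last index with `k i ≠ 0`. Earlier coordinates have smaller degree, so their top
  -- difference vanishes and only `k i • α` survives.
  have hsum := IsPolyPhase.sum (r := i.val + 1) Finset.univ
    (β := fun j => if j = i then k i • (α : UnitAddCircle) else 0)
    (u := fun j n => k j • (skewShift d α)^[n] y j) (fun j _ => ?_)
  · simpa using hsum
  · have hj := (isPolyPhase_skewShift d α y j).zsmul (k j)
    rcases lt_trichotomy j i with h | h | h
    · rw [if_neg h.ne]
      exact hj.zero_of_lt (by have : j.val < i.val := h; omega)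
    · subst h
      simpa using hj
    · have : k j = 0 := by
        by_contra h0
        exact absurd (hmax j (by simpa using h0)) (not_le.2 h)
      rw [if_neg h.ne']
      simpa [this] using IsPolyPhase.zero (i.val + 1)

/-! ### Weyl sums: van der Corput differencing and rational approximation. -/

theorem norm_sum_range_add_sub_le {w : ℕ → ℂ} (hw : ∀ n, ‖w n‖ ≤ 1) (N h : ℕ) :
    ‖∑ n ∈ Finset.range N, w (n + h) - ∑ n ∈ Finset.range N, w n‖ ≤ 2 * h := by
  have h1 : ∑ n ∈ Finset.range N, w (n + h) - ∑ n ∈ Finset.range N, w n =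
      ∑ n ∈ Finset.range h, w (N + n) - ∑ n ∈ Finset.range h, w n := by
    have ha := Finset.sum_range_add w N h
    have hb := Finset.sum_range_add w h N
    rw [add_comm h N, ha] at hb
    simp only [add_comm _ h]
    linear_combination -hb
  have h2 : ∀ v : ℕ → ℂ, (∀ n, ‖v n‖ ≤ 1) → ‖∑ n ∈ Finset.range h, v n‖ ≤ h := fun v hv => by
    simpa using norm_sum_le_of_le (Finset.range h) (fun n _ => hv n)
  rw [h1]
  linarith [norm_sub_le (∑ n ∈ Finset.range h, w (N + n)) (∑ n ∈ Finset.range h, w n),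
    h2 _ hw, h2 (fun n => w (N + n)) fun n => hw _]

/-- A form of van der Corput's inequality. -/
theorem norm_sum_range_le_of_correlation_le {w : ℕ → ℂ} (hw : ∀ n, ‖w n‖ ≤ 1) (N : ℕ) {H : ℕ}
    (hH : 0 < H) {B : ℝ} (hB0 : 0 ≤ B)
    (hB : ∀ h < H, ∀ h' < h,
      ‖∑ n ∈ Finset.range N, w (n + h) * (starRingEnd ℂ) (w (n + h'))‖ ≤ B) :
    ‖∑ n ∈ Finset.range N, w n‖ ≤ 2 * H + √((N : ℝ) ^ 2 / H + N * B) := by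
  set S := ∑ n ∈ Finset.range N, w n with hS
  -- Averaging over windows of length `H`: `T` differs from `H * S` only by boundary terms, and
  -- Cauchy–Schwarz on `T` produces the correlations, whose diagonal contributes `H * N`.
  set T := ∑ n ∈ Finset.range N, ∑ h ∈ Finset.range H, w (n + h) with hT
  have hHr : (0 : ℝ) < H := by exact_mod_cast hH
  have h1 : ‖T - H * S‖ ≤ H * (2 * H) := by
    have : T - H * S = ∑ h ∈ Finset.range H, (∑ n ∈ Finset.range N, w (n + h) - S) := by
      rw [hT, Finset.sum_comm, Finset.sum_sub_distrib]
      simp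
    rw [this]
    have := norm_sum_le_of_le (Finset.range H) (f := fun h => ∑ n ∈ Finset.range N, w (n + h) - S)
      (n := fun _ => (2 * H : ℝ)) fun h hh => by
        refine (norm_sum_range_add_sub_le hw N h).trans ?_
        have : (h : ℝ) ≤ H := by exact_mod_cast (Finset.mem_range.1 hh).le
        linarith
    simpa using this
  have hcorr : ∀ h ∈ Finset.range H, ∀ h' ∈ Finset.range H,
      ‖∑ n ∈ Finset.range N, w (n + h) * (starRingEnd ℂ) (w (n + h'))‖ ≤
        B + if h = h' then (N : ℝ) else 0 := by
    intro h hh h' hh'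
    rw [Finset.mem_range] at hh hh'
    rcases lt_trichotomy h' h with hlt | rfl | hlt
    · simpa [hlt.ne'] using hB h hh h' hlt
    · have := norm_sum_le_of_le (Finset.range N)
        (f := fun n => w (n + h') * (starRingEnd ℂ) (w (n + h'))) (n := fun _ => (1 : ℝ))
        fun n _ => by
          rw [norm_mul, RCLike.norm_conj]
          exact mul_le_one₀ (hw _) (norm_nonneg _) (hw _)
      simp only [Finset.sum_const, Finset.card_range, nsmul_eq_mul, mul_one] at this
      rw [if_pos rfl]
      linarith
    · have := hB h' hh' h hlt
      rw [if_neg hlt.ne, add_zero]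
      rw [← RCLike.norm_conj, map_sum] at this
      simpa [mul_comm] using this
  have h2 : ∑ n ∈ Finset.range N, ‖∑ h ∈ Finset.range H, w (n + h)‖ ^ 2 ≤ H * N + H ^ 2 * B := by
    have hid : ((∑ n ∈ Finset.range N, ‖∑ h ∈ Finset.range H, w (n + h)‖ ^ 2 : ℝ) : ℂ) =
        ∑ h ∈ Finset.range H, ∑ h' ∈ Finset.range H,
          ∑ n ∈ Finset.range N, w (n + h) * (starRingEnd ℂ) (w (n + h')) := by
      push_cast
      simp_rw [← Complex.mul_conj', map_sum, Finset.sum_mul_sum]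
      rw [Finset.sum_comm]
      refine Finset.sum_congr rfl fun h _ => ?_
      rw [Finset.sum_comm]
    have hnn : 0 ≤ ∑ n ∈ Finset.range N, ‖∑ h ∈ Finset.range H, w (n + h)‖ ^ 2 :=
      Finset.sum_nonneg fun _ _ => by positivity
    rw [← Complex.norm_of_nonneg hnn, hid]
    refine (norm_sum_le_of_le _ fun h hh => norm_sum_le_of_le _ fun h' hh' =>
      hcorr h hh h' hh').trans (le_of_eq ?_)
    simp only [Finset.sum_add_distrib, Finset.sum_const, Finset.card_range, nsmul_eq_mul,
      Finset.sum_ite_eq, Finset.mem_range]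
    rw [Finset.sum_congr rfl fun h hh => if_pos (Finset.mem_range.1 hh)]
    simp
    ring
  have h3 : ‖T‖ ^ 2 ≤ N * (H * N + H ^ 2 * B) := by
    calc ‖T‖ ^ 2 ≤ (∑ n ∈ Finset.range N, ‖∑ h ∈ Finset.range H, w (n + h)‖) ^ 2 := by
          gcongr; exact norm_sum_le _ _
      _ ≤ N * ∑ n ∈ Finset.range N, ‖∑ h ∈ Finset.range H, w (n + h)‖ ^ 2 := by
          simpa using sq_sum_le_card_mul_sum_sq (s := Finset.range N)
            (f := fun n => ‖∑ h ∈ Finset.range H, w (n + h)‖)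
      _ ≤ _ := by gcongr
  have h4 : ‖T‖ ≤ H * √((N : ℝ) ^ 2 / H + N * B) := by
    refine le_of_sq_le_sq ?_ (by positivity)
    rw [mul_pow, Real.sq_sqrt (by positivity)]
    refine h3.trans (le_of_eq ?_)
    field_simp
  have h5 : (H : ℝ) * ‖S‖ ≤ ‖T‖ + H * (2 * H) := by
    have : (H : ℝ) * ‖S‖ = ‖(H : ℂ) * S‖ := by simp
    rw [this]
    have := norm_sub_le T (T - H * S)
    rw [sub_sub_cancel] at this
    linarith
  have h6 : (H : ℝ) * ‖S‖ ≤ H * (2 * H + √((N : ℝ) ^ 2 / H + N * B)) := by linarith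
  exact le_of_mul_le_mul_left h6 hHr

theorem norm_coe_le_abs_sub_intCast (t : ℝ) (m : ℤ) : ‖(t : UnitAddCircle)‖ ≤ |t - m| := by
  rw [UnitAddCircle.norm_eq]
  exact round_le t m

/-- As `q` does not divide `a * p`, the integer `a * p - m * q` is nonzero. Replacing `p / q` by `α`
changes it by at most `|a| / q ≤ 1 / 2`, which leaves at least `1 / 2`. -/
theorem le_norm_zsmul_of_abs_sub_div_le {α : ℝ} {q : ℕ} (hq : 0 < q) {p : ℤ}
    (hpq : IsCoprime p (q : ℤ)) (hα : |α - p / q| ≤ 1 / (q : ℝ) ^ 2) {a : ℤ} (ha : a ≠ 0)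
    (haq : 2 * |a| ≤ q) : 1 / (2 * q : ℝ) ≤ ‖a • (α : UnitAddCircle)‖ := by
  have hq' : (0 : ℝ) < q := by exact_mod_cast hq
  rw [← AddCircle.coe_zsmul, zsmul_eq_mul, UnitAddCircle.norm_eq]
  set m := round ((a : ℝ) * α)
  have hne : a * p - m * q ≠ 0 := by
    intro h0
    have hdvd : (q : ℤ) ∣ a * p := ⟨m, by linarith⟩
    have := Int.le_of_dvd (abs_pos.2 ha) ((dvd_abs _ _).2 (hpq.symm.dvd_of_dvd_mul_right hdvd))
    have := abs_pos.2 ha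
    omega
  have h1 : (1 : ℝ) ≤ |(a : ℝ) * p - m * q| := by
    exact_mod_cast Int.one_le_abs hne
  have h2 : (2 : ℝ) * |(a : ℝ)| ≤ q := by exact_mod_cast haq
  have h3 : |(a : ℝ) * p - m * q| ≤ q * |a * α - m| + q * (|(a : ℝ)| * |α - p / q|) := by
    have h := norm_sub_le (q * (a * α - m)) (q * (a * (α - p / q)))
    have he : q * (a * α - m) - q * (a * (α - p / q)) = (a : ℝ) * p - m * q := by
      field_simp
      ring
    rw [he] at h
    simpa only [Real.norm_eq_abs, abs_mul, abs_of_pos hq'] using h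
  have h4 : q * (|(a : ℝ)| * |α - p / q|) ≤ 1 / 2 := by
    calc q * (|(a : ℝ)| * |α - p / q|) ≤ q * (q / 2 * (1 / (q : ℝ) ^ 2)) := by
          gcongr; linarith
      _ = 1 / 2 := by field_simp
  rw [div_le_iff₀ (by positivity)]
  linarith

theorem norm_nsmul_le_of_abs_sub_div_le {α : ℝ} {q : ℕ} (hq : 0 < q) {p : ℤ}
    (hα : |α - p / q| ≤ 1 / (q : ℝ) ^ 2) : ‖q • (α : UnitAddCircle)‖ ≤ 1 / q := by
  have hq' : (0 : ℝ) < q := by exact_mod_cast hq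
  rw [← AddCircle.coe_nsmul, nsmul_eq_mul]
  refine (norm_coe_le_abs_sub_intCast _ p).trans ?_
  have : (q : ℝ) * α - p = q * (α - p / q) := by field_simp
  rw [this, abs_mul, abs_of_pos hq']
  calc (q : ℝ) * |α - p / q| ≤ q * (1 / (q : ℝ) ^ 2) := by gcongr
    _ = 1 / q := by field_simp

/-- In the geometric sum the numerator is of order `|a| / q` and the denominator at least of order
`1 / q`; the exact quotient of the bounds is `π * |a|`. -/
theorem IsPolyPhase.norm_sum_le_of_degree_one {α : ℝ} {q : ℕ} (hq : 0 < q) {p : ℤ}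
    (hpq : IsCoprime p (q : ℤ)) (hα : |α - p / q| ≤ 1 / (q : ℝ) ^ 2) {a : ℤ} (ha : a ≠ 0)
    (haq : 2 * |a| ≤ q) {u : ℕ → UnitAddCircle} (hu : IsPolyPhase 1 (a • (α : UnitAddCircle)) u) :
    ‖∑ n ∈ Finset.range q, (AddCircle.toCircle (u n) : ℂ)‖ ≤ 4 * |(a : ℝ)| := by
  have hq' : (0 : ℝ) < q := by exact_mod_cast hq
  set β := a • (α : UnitAddCircle) with hβ
  have h1 : ∑ n ∈ Finset.range q, (AddCircle.toCircle (u n) : ℂ) =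
      AddCircle.toCircle (u 0) * ∑ n ∈ Finset.range q, (AddCircle.toCircle (n • β) : ℂ) := by
    rw [Finset.mul_sum]
    refine Finset.sum_congr rfl fun n _ => ?_
    rw [hu.eq_add_nsmul n, UnitAddCircle.coe_toCircle_add]
  rw [h1, norm_mul, Circle.norm_coe, one_mul]
  have h2 := UnitAddCircle.norm_sum_toCircle_nsmul_mul_le β q
  have h3 : ‖q • β‖ ≤ |(a : ℝ)| * (1 / q) := by
    rw [hβ, smul_comm]
    refine (norm_zsmul_le _ _).trans ?_
    rw [Int.norm_eq_abs]
    gcongr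
    exact norm_nsmul_le_of_abs_sub_div_le hq hα
  have h4 := le_norm_zsmul_of_abs_sub_div_le hq hpq hα ha haq
  set X := ‖∑ n ∈ Finset.range q, (AddCircle.toCircle (n • β) : ℂ)‖
  have hX : 0 ≤ X := norm_nonneg _
  have h5 : X * (4 * (1 / (2 * q))) ≤ 2 * Real.pi * (|(a : ℝ)| * (1 / q)) := by
    calc X * (4 * (1 / (2 * q))) ≤ X * (4 * ‖β‖) := by gcongr
      _ ≤ _ := h2
      _ ≤ _ := by gcongr
  have h6 : X * (4 * (1 / (2 * q))) = 2 * X / q := by field_simp; ring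
  have h7 : 2 * Real.pi * (|(a : ℝ)| * (1 / q)) = 2 * Real.pi * |(a : ℝ)| / q := by field_simp
  rw [h6, h7, div_le_div_iff_of_pos_right hq'] at h5
  nlinarith [Real.pi_lt_four, abs_nonneg (a : ℝ)]

/-- Power-saving bound for Weyl sums over a full period of a rational approximation. -/
theorem IsPolyPhase.norm_sum_le {α : ℝ} {q : ℕ} (hq : 0 < q) {p : ℤ}
    (hpq : IsCoprime p (q : ℤ)) (hα : |α - p / q| ≤ 1 / (q : ℝ) ^ 2) {d L H : ℕ} (hd : 1 ≤ d)
    (hL : 0 < L) (hH : H = L ^ 2 ^ d) (hqH : 4 * H ^ (d + 1) ≤ q) {r : ℕ} (hr : r + 1 ≤ d)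
    {a : ℤ} (ha : a ≠ 0) (haH : |a| * H ^ r ≤ H ^ d) {u : ℕ → UnitAddCircle}
    (hu : IsPolyPhase (r + 1) (a • (α : UnitAddCircle)) u) :
    ‖∑ n ∈ Finset.range q, (AddCircle.toCircle (u n) : ℂ)‖ ≤ 5 * (q / (L : ℝ) ^ 2 ^ (d - r)) := by
  have hq' : (0 : ℝ) < q := by exact_mod_cast hq
  have hHpos : 0 < H := by rw [hH]; positivity
  have hLr : (1 : ℝ) ≤ L := by exact_mod_cast hL
  have hH' : (1 : ℝ) ≤ H := by exact_mod_cast hHpos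
  have hqHr : 4 * (H : ℝ) ^ (d + 1) ≤ q := by exact_mod_cast hqH
  have hHL : (H : ℝ) = (L : ℝ) ^ 2 ^ d := by exact_mod_cast hH
  -- The condition `|a| * H ^ r ≤ H ^ d` is preserved by differencing: the degree drops by one while
  -- `a` gains a factor below `H`. At degree one it still keeps `2 * |a| ≤ q`.
  induction r generalizing a u with
  | zero =>
    have ha1 : |a| ≤ (H : ℤ) ^ d := by simpa using haH
    have ha2 : |(a : ℝ)| ≤ (H : ℝ) ^ d := by exact_mod_cast ha1
    have ha3 : (H : ℤ) ^ d ≤ (H : ℤ) ^ (d + 1) :=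
      pow_le_pow_right₀ (by exact_mod_cast hHpos) d.le_succ
    have hqH' : 4 * (H : ℤ) ^ (d + 1) ≤ q := by exact_mod_cast hqH
    have h1 := IsPolyPhase.norm_sum_le_of_degree_one hq hpq hα ha
      (by have : 0 ≤ |a| := abs_nonneg a; linarith) hu
    refine h1.trans ?_
    rw [Nat.sub_zero, ← hHL]
    have : 4 * (H : ℝ) ^ d ≤ q / H := by
      rw [le_div_iff₀ (by positivity)]
      calc 4 * (H : ℝ) ^ d * H = 4 * (H : ℝ) ^ (d + 1) := by ring
        _ ≤ q := hqHr
    have : 0 ≤ q / (H : ℝ) := by positivity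
    linarith
  | succ r ih =>
    obtain ⟨e, he⟩ : ∃ e, d - (r + 1) = e := ⟨_, rfl⟩
    have he' : d - r = e + 1 := by omega
    -- Correlations save `M ^ 2` by induction, and the square root in van der Corput's inequality
    -- halves the exponent to `M`. The constant `5` reproduces itself: `1` from the boundary term
    -- and at most `4` from the root.
    set M := (L : ℝ) ^ 2 ^ e with hM
    have hM2 : (L : ℝ) ^ 2 ^ (e + 1) = M ^ 2 := by rw [hM, pow_succ, pow_mul]
    have hM1 : 1 ≤ M := one_le_pow₀ hLr
    have hMH : M ^ 2 ≤ H := by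
      rw [← hM2, hHL]
      exact pow_le_pow_right₀ hLr (Nat.pow_le_pow_right two_pos (by omega))
    rw [he', hM2] at ih
    rw [he]
    have hvdc := norm_sum_range_le_of_correlation_le
      (w := fun n => (AddCircle.toCircle (u n) : ℂ)) (fun n => (Circle.norm_coe _).le) q hHpos
      (B := 5 * (q / M ^ 2)) (by positivity) (fun h hh h' hh' => ?_)
    · refine hvdc.trans ?_
      have h1 : (2 : ℝ) * H ≤ q / M := by
        rw [le_div_iff₀ (by positivity)]
        have hHH : (H : ℝ) * H ≤ H ^ (d + 1) := by
          rw [← sq]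
          exact pow_le_pow_right₀ hH' (by omega)
        have hMH' : M ≤ H := by nlinarith
        nlinarith
      have h2 : √((q : ℝ) ^ 2 / H + q * (5 * (q / M ^ 2))) ≤ 4 * (q / M) := by
        rw [Real.sqrt_le_left (by positivity)]
        have : (q : ℝ) ^ 2 / H ≤ q ^ 2 / M ^ 2 := by gcongr
        have e1 : (q : ℝ) * (5 * (q / M ^ 2)) = 5 * (q ^ 2 / M ^ 2) := by ring
        have e2 : (4 * (q / M)) ^ 2 = 16 * ((q : ℝ) ^ 2 / M ^ 2) := by ring
        have : 0 ≤ (q : ℝ) ^ 2 / M ^ 2 := by positivity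
        linarith
      linarith
    -- The correlation at `h, h'` is the Weyl sum of a phase of one degree less, with `a` replaced
    -- by `(h - h') * a`.
    · have hv := (hu (h - h')).shift h'
      have hcast : (h - h') • a • (α : UnitAddCircle) = (((h - h' : ℕ) : ℤ) * a) •
          (α : UnitAddCircle) := by
        rw [mul_smul, natCast_zsmul]
      rw [hcast] at hv
      refine le_trans (le_of_eq ?_) (ih (by omega) (mul_ne_zero (by omega) ha) ?_ hv)
      · congr 1
        refine Finset.sum_congr rfl fun n _ => ?_
        rw [show n + h' + (h - h') = n + h by omega, sub_eq_add_neg,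
          UnitAddCircle.coe_toCircle_add, AddCircle.toCircle_neg, Circle.coe_inv_eq_conj]
      · rw [abs_mul, Nat.abs_cast]
        calc ((h - h' : ℕ) : ℤ) * |a| * (H : ℤ) ^ r ≤ H * |a| * (H : ℤ) ^ r := by
              gcongr
              omega
          _ = |a| * (H : ℤ) ^ (r + 1) := by ring
          _ ≤ _ := haH

/-! ### Arcs of the circle. -/

/-- The half-open arc of the circle parametrized by `[a, b)`. -/
def circleArc (a b : ℝ) : Set UnitAddCircle :=
  {x | ∃ t ∈ Set.Ico a b, (t : UnitAddCircle) = x}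

theorem circleArc_eq_empty {a b : ℝ} (h : b ≤ a) : circleArc a b = ∅ := by
  simp [circleArc, Set.Ico_eq_empty_of_le h]

theorem exists_mem_Ico_coe_eq (a : ℝ) (x : UnitAddCircle) :
    ∃ s ∈ Set.Ico a (a + 1), (s : UnitAddCircle) = x := by
  have h := AddCircle.coe_image_Ico_eq (1 : ℝ) a
  have hx : x ∈ ((↑) : ℝ → UnitAddCircle) '' Set.Ico a (a + 1) := by
    rw [h]; trivial
  exact hx

theorem circleArc_eq_univ {a b : ℝ} (h : 1 ≤ b - a) : circleArc a b = Set.univ := by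
  refine Set.eq_univ_of_forall fun x => ?_
  obtain ⟨s, hs, rfl⟩ := exists_mem_Ico_coe_eq a x
  exact ⟨s, ⟨hs.1, by linarith [hs.2]⟩, rfl⟩

/-- This is what lets majorants alone give two-sided estimates. -/
theorem exists_compl_circleArc_eq (a b : ℝ) : ∃ a' b', (circleArc a b)ᶜ = circleArc a' b' := by
  rcases le_or_gt b a with h | h
  · exact ⟨0, 1, by rw [circleArc_eq_empty h, circleArc_eq_univ (by norm_num), Set.compl_empty]⟩
  rcases le_or_gt 1 (b - a) with h1 | h1
  · exact ⟨0, 0, by rw [circleArc_eq_univ h1, circleArc_eq_empty le_rfl, Set.compl_univ]⟩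
  refine ⟨b, a + 1, Set.ext fun x => ?_⟩
  obtain ⟨s, hs, rfl⟩ := exists_mem_Ico_coe_eq a x
  have key : ∀ t ∈ Set.Ico a (a + 1), (t : UnitAddCircle) = s → t = s := fun t ht he =>
    (AddCircle.coe_eq_coe_iff_of_mem_Ico (p := (1 : ℝ)) ht hs).1 he
  constructor
  · intro hx
    refine ⟨s, ⟨?_, hs.2⟩, rfl⟩
    by_contra hlt
    exact hx ⟨s, ⟨hs.1, not_le.1 hlt⟩, rfl⟩
  · rintro ⟨t, ht, hts⟩ ⟨t', ht', hts'⟩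
    have h2 := key t ⟨by linarith [ht.1], ht.2⟩ hts
    have h3 := key t' ⟨ht'.1, by linarith [ht'.2]⟩ hts'
    linarith [ht.1, ht'.2]

theorem measurableSet_circleArc (a b : ℝ) : MeasurableSet (circleArc a b) := by
  rcases le_or_gt b a with h | h
  · rw [circleArc_eq_empty h]; exact MeasurableSet.empty
  have : circleArc a b = {(a : UnitAddCircle)} ∪ ((↑) : ℝ → UnitAddCircle) '' Set.Ioo a b := by
    change ((↑) : ℝ → UnitAddCircle) '' Set.Ico a b = _
    rw [← Set.Ioo_union_left h, Set.image_union, Set.image_singleton, Set.union_comm]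
  rw [this]
  exact (measurableSet_singleton _).union
    (QuotientAddGroup.isOpenMap_coe _ isOpen_Ioo).measurableSet

theorem volume_real_circleArc {a b : ℝ} (hab : a ≤ b) (h : b - a ≤ 1) :
    volume.real (circleArc a b) = b - a := by
  have hm := UnitAddCircle.measurePreserving_mk a
  have h1 : volume (circleArc a b) =
      volume (((↑) : ℝ → UnitAddCircle) ⁻¹' circleArc a b ∩ Set.Ioc a (a + 1)) := by
    rw [← hm.measure_preimage (measurableSet_circleArc a b).nullMeasurableSet,
      Measure.restrict_apply' measurableSet_Ioc]
  have h2 : Set.Ioo a b ⊆ ((↑) : ℝ → UnitAddCircle) ⁻¹' circleArc a b ∩ Set.Ioc a (a + 1) :=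
    fun t ht => ⟨⟨t, ⟨ht.1.le, ht.2⟩, rfl⟩, ht.1, by linarith [ht.2]⟩
  -- The fundamental domain `(a, a + 1]` is closed on the opposite side from the arc, so the point
  -- `a + 1` can intrude; it is null.
  have h3 : ((↑) : ℝ → UnitAddCircle) ⁻¹' circleArc a b ∩ Set.Ioc a (a + 1) ⊆
      Set.Ico a b ∪ {a + 1} := by
    rintro x ⟨⟨t, ht, htx⟩, hx⟩
    rcases eq_or_lt_of_le hx.2 with h' | h'
    · exact Or.inr h'
    · left
      have := (AddCircle.coe_eq_coe_iff_of_mem_Ico (p := (1 : ℝ)) (a := a)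
        ⟨ht.1, by linarith [ht.2]⟩ ⟨hx.1.le, h'⟩).1 htx
      exact this ▸ ht
  have h4 : volume (circleArc a b) = ENNReal.ofReal (b - a) := by
    rw [h1]
    refine le_antisymm ((measure_mono h3).trans ((measure_union_le _ _).trans ?_)) ?_
    · simp
    · simpa using measure_mono (μ := volume) h2
  rw [measureReal_def, h4, ENNReal.toReal_ofReal (by linarith)]

/-! ### Fejér kernel and trigonometric majorants of arcs. -/

theorem integral_fourier_neg (k : ℤ) :
    ∫ t : UnitAddCircle, fourier (-k) t = if k = 0 then (1 : ℂ) else 0 := by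
  have h := congrFun (fourierCoeff_fourier (T := (1 : ℝ)) 0) k
  have hv : (volume : Measure UnitAddCircle) = AddCircle.haarAddCircle := by
    rw [AddCircle.volume_eq_smul_haarAddCircle]; simp
  rw [hv]
  simp only [fourierCoeff, fourier_zero, smul_eq_mul, mul_one] at h
  rw [h, Pi.single_apply]

/-- The Fejér kernel of order `K` on the circle. -/
noncomputable def fejerKernel (K : ℕ) (x : UnitAddCircle) : ℝ :=
  ‖∑ j ∈ Finset.range K, (AddCircle.toCircle (j • x) : ℂ)‖ ^ 2 / K

theorem fejerKernel_nonneg (K : ℕ) (x : UnitAddCircle) : 0 ≤ fejerKernel K x := by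
  unfold fejerKernel; positivity

theorem coe_fejerKernel (K : ℕ) (x : UnitAddCircle) :
    (fejerKernel K x : ℂ) = ∑ P ∈ Finset.range K ×ˢ Finset.range K,
      (K : ℂ)⁻¹ * fourier ((P.1 : ℤ) - P.2) x := by
  rw [fejerKernel, ← Finset.mul_sum, Finset.sum_product]
  push_cast
  rw [← Complex.mul_conj', map_sum, Finset.sum_mul_sum, div_eq_inv_mul]
  congr 1
  refine Finset.sum_congr rfl fun i _ => Finset.sum_congr rfl fun j _ => ?_
  rw [fourier_apply, sub_smul, sub_eq_add_neg, UnitAddCircle.coe_toCircle_add,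
    AddCircle.toCircle_neg, Circle.coe_inv_eq_conj, natCast_zsmul, natCast_zsmul]

theorem continuous_fejerKernel (K : ℕ) : Continuous (fejerKernel K) := by
  unfold fejerKernel
  have : ∀ j : ℕ, Continuous fun x : UnitAddCircle => (AddCircle.toCircle (j • x) : ℂ) := fun j =>
    continuous_subtype_val.comp (AddCircle.continuous_toCircle.comp (continuous_nsmul j))
  fun_prop

/-- The geometric sum is at most `1 / ‖x‖` whatever its length, since `‖K • x‖ ≤ 1 / 2`. -/
theorem fejerKernel_le {K : ℕ} {x : UnitAddCircle} {η : ℝ} (hη : 0 < η) (hx : η ≤ ‖x‖) :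
    fejerKernel K x ≤ 1 / η ^ 2 / K := by
  unfold fejerKernel
  have h := UnitAddCircle.norm_sum_toCircle_nsmul_mul_le x K
  have h1 := UnitAddCircle.norm_le_half (K • x)
  set X := ‖∑ j ∈ Finset.range K, (AddCircle.toCircle (j • x) : ℂ)‖ with hX
  have hX0 : 0 ≤ X := norm_nonneg _
  have h2 : X * (4 * η) ≤ 4 := by
    calc X * (4 * η) ≤ X * (4 * ‖x‖) := by gcongr
      _ ≤ 2 * Real.pi * ‖K • x‖ := h
      _ ≤ 2 * Real.pi * (1 / 2) := by gcongr
      _ ≤ 4 := by linarith [Real.pi_lt_four]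
  have h3 : X ≤ 1 / η := by
    rw [le_div_iff₀ hη]; linarith
  have h4 : X ^ 2 ≤ 1 / η ^ 2 := by
    calc X ^ 2 ≤ (1 / η) ^ 2 := by gcongr
      _ = 1 / η ^ 2 := by rw [div_pow, one_pow]
  gcongr

theorem integrableOn_fejerKernel_sub (K : ℕ) (S : Set UnitAddCircle) (x : UnitAddCircle) :
    IntegrableOn (fun t => fejerKernel K (x - t)) S :=
  (((continuous_fejerKernel K).comp (continuous_const.sub continuous_id)).integrable_of_hasCompactSupport
    (HasCompactSupport.of_compactSpace _)).integrableOn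

/-- The convolution of an indicator with the Fejér kernel is a trigonometric polynomial in `x`, here
with explicit coefficients. -/
theorem coe_setIntegral_fejerKernel_sub (K : ℕ) (S : Set UnitAddCircle) (x : UnitAddCircle) :
    ((∫ t in S, fejerKernel K (x - t) : ℝ) : ℂ) =
      ∑ P ∈ Finset.range K ×ˢ Finset.range K,
        ((K : ℂ)⁻¹ * ∫ t in S, fourier (-((P.1 : ℤ) - P.2)) t) * fourier ((P.1 : ℤ) - P.2) x := by
  rw [← integral_complex_ofReal]
  have : ∀ t, (fejerKernel K (x - t) : ℂ) = ∑ P ∈ Finset.range K ×ˢ Finset.range K,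
      ((K : ℂ)⁻¹ * fourier ((P.1 : ℤ) - P.2) x) * fourier (-((P.1 : ℤ) - P.2)) t := by
    intro t
    rw [coe_fejerKernel]
    refine Finset.sum_congr rfl fun P _ => ?_
    rw [mul_assoc, fourier_apply, fourier_apply, fourier_apply, smul_sub, neg_smul, sub_eq_add_neg,
      UnitAddCircle.coe_toCircle_add]
  simp_rw [this]
  rw [integral_finsetSum]
  · refine Finset.sum_congr rfl fun P _ => ?_
    rw [integral_const_mul]
    ring
  · intro P _
    refine Integrable.const_mul ?_ _
    exact ((fourier _).continuous.integrable_of_hasCompactSupport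
      (HasCompactSupport.of_compactSpace _)).integrableOn

theorem integral_fejerKernel_sub {K : ℕ} (hK : 0 < K) (x : UnitAddCircle) :
    ∫ t, fejerKernel K (x - t) = 1 := by
  have h := coe_setIntegral_fejerKernel_sub K Set.univ x
  simp only [Measure.restrict_univ, integral_fourier_neg] at h
  have hK' : (K : ℂ) ≠ 0 := by exact_mod_cast hK.ne'
  rw [Finset.sum_product] at h
  have h2 : ∀ i ∈ Finset.range K, ∑ j ∈ Finset.range K,
      ((K : ℂ)⁻¹ * if (i : ℤ) - j = 0 then (1 : ℂ) else 0) * fourier ((i : ℤ) - j) x =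
        (K : ℂ)⁻¹ := by
    intro i hi
    rw [Finset.sum_eq_single i]
    · simp
    · intro j _ hj
      rw [if_neg (by omega)]
      simp
    · exact fun h => absurd hi h
  rw [Finset.sum_congr rfl h2] at h
  simp only [Finset.sum_const, Finset.card_range, nsmul_eq_mul, mul_inv_cancel₀ hK'] at h
  exact_mod_cast h

/-- The indicator function of `A` is bounded above by a real trigonometric polynomial of degree at
most `K` with coefficients bounded by `B`, whose mean is at most `η` more than the measure of
`A`. -/
def HasTrigMajorant (A : Set UnitAddCircle) (K : ℕ) (B η : ℝ) : Prop :=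
  ∃ c : ℤ → ℂ, (∀ k, ‖c k‖ ≤ B) ∧ (∃ v : ℝ, c 0 = v ∧ 0 ≤ v ∧ v ≤ volume.real A + η) ∧
    ∀ x, ∃ g : ℝ, ∑ k ∈ Finset.Icc (-K : ℤ) K, c k * fourier k x = g ∧
      A.indicator (fun _ => (1 : ℝ)) x ≤ g

/-- Seen from a point of the arc, everything outside the arc widened by `η` is at distance at least
`η`, where the kernel is at most `1 / η ^ 2 / K`; its total mass is `1`. -/
theorem one_sub_le_setIntegral_fejerKernel {K : ℕ} (hK : 0 < K) {a b η : ℝ} (hη : 0 < η)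
    {x : UnitAddCircle} (hx : x ∈ circleArc a b) :
    1 - 1 / η ^ 2 / K ≤ ∫ t in circleArc (a - η) (b + η), fejerKernel K (x - t) := by
  have hint := integrableOn_fejerKernel_sub K Set.univ x
  rw [integrableOn_univ] at hint
  have hadd := integral_add_compl (measurableSet_circleArc (a - η) (b + η)) hint
  rw [integral_fejerKernel_sub hK] at hadd
  have hc : ∫ t in (circleArc (a - η) (b + η))ᶜ, fejerKernel K (x - t) ≤ 1 / η ^ 2 / K := by
    have hle : ∀ t ∈ (circleArc (a - η) (b + η))ᶜ, fejerKernel K (x - t) ≤ 1 / η ^ 2 / K := by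
      intro t ht
      refine fejerKernel_le hη ?_
      by_contra hlt
      rw [not_le] at hlt
      obtain ⟨s, hs, hs'⟩ := UnitAddCircle.exists_coe_eq_abs_eq_norm (x - t)
      obtain ⟨r, hr, rfl⟩ := hx
      rw [← hs', abs_lt] at hlt
      refine ht ⟨r - s, ⟨by linarith [hr.1], by linarith [hr.2]⟩, ?_⟩
      rw [AddCircle.coe_sub, hs, sub_sub_cancel]
    calc ∫ t in (circleArc (a - η) (b + η))ᶜ, fejerKernel K (x - t)
        ≤ ∫ t in (circleArc (a - η) (b + η))ᶜ, 1 / η ^ 2 / K :=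
          setIntegral_mono_on (integrableOn_fejerKernel_sub K _ x)
            (integrableOn_const (measure_ne_top _ _)) (measurableSet_circleArc _ _).compl hle
      _ = volume.real (circleArc (a - η) (b + η))ᶜ * (1 / η ^ 2 / K) := by simp
      _ ≤ 1 * (1 / η ^ 2 / K) := by
          gcongr
          refine (measureReal_mono (Set.subset_univ _)).trans (le_of_eq ?_)
          simp [measureReal_def]
      _ = _ := one_mul _
  linarith

theorem norm_setIntegral_fourier_le (S : Set UnitAddCircle) (k : ℤ) :
    ‖∫ t in S, fourier k t‖ ≤ 1 := by
  refine (norm_integral_le_of_norm_le_const (C := 1) (Filter.Eventually.of_forall fun t => ?_)).trans ?_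
  · rw [fourier_apply, Circle.norm_coe]
  · rw [one_mul, measureReal_def, Measure.restrict_apply_univ, ← measureReal_def]
    refine (measureReal_mono (Set.subset_univ _)).trans (le_of_eq ?_)
    simp [measureReal_def]

theorem hasTrigMajorant_of_univ {A : Set UnitAddCircle} {K : ℕ} {B η : ℝ} (hB : 1 ≤ B)
    (h : 1 ≤ volume.real A + η) : HasTrigMajorant A K B η := by
  refine ⟨fun k => if k = 0 then 1 else 0, fun k => ?_, ⟨1, by simp, zero_le_one, h⟩, fun x =>
    ⟨1, ?_, Set.indicator_le_self' (fun _ _ => zero_le_one) x⟩⟩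
  · beta_reduce
    split_ifs <;> simp <;> linarith
  · rw [Finset.sum_eq_single 0]
    · simp
    · intro k _ hk
      simp [hk]
    · intro h0
      exact absurd (Finset.mem_Icc.2 ⟨by omega, by omega⟩) h0

theorem hasTrigMajorant_circleArc (a b : ℝ) {m : ℕ} (hm : 2 ≤ m) :
    HasTrigMajorant (circleArc a b) (m ^ 4) (2 * (m : ℝ) ^ 4) (6 / m) := by
  have hm' : (2 : ℝ) ≤ m := by exact_mod_cast hm
  have hm0 : (0 : ℝ) < m := by linarith
  have hB : (1 : ℝ) ≤ m ^ 4 := one_le_pow₀ (by linarith)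
  rcases le_or_gt b a with hba | hab
  · rw [circleArc_eq_empty hba]
    exact ⟨fun _ => 0, fun _ => by simp, ⟨0, by simp, le_rfl, by simp; positivity⟩,
      fun x => ⟨0, by simp, by simp⟩⟩
  rcases le_or_gt 1 (b - a) with h1 | h1
  · refine hasTrigMajorant_of_univ (by linarith) ?_
    rw [circleArc_eq_univ h1]
    have : 0 ≤ 6 / (m : ℝ) := by positivity
    simp [measureReal_def, this]
  have hvol := volume_real_circleArc hab.le h1.le
  -- If the widened arc would cover the circle, the constant `1` is already a good enough majorant.
  rcases le_or_gt 1 (b - a + 2 / m) with h2 | h2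
  · refine hasTrigMajorant_of_univ (by linarith) ?_
    rw [hvol]
    have : 2 / (m : ℝ) ≤ 6 / m := by gcongr; norm_num
    linarith
  set K := m ^ 4 with hK
  have hK0 : 0 < K := by positivity
  have hKr : (K : ℝ) = (m : ℝ) ^ 4 := by rw [hK]; push_cast; rfl
  set S := circleArc (a - 1 / m) (b + 1 / m) with hS
  have hSvol : volume.real S = b - a + 2 / m := by
    rw [hS, volume_real_circleArc]
    · ring
    · have : 0 < 1 / (m : ℝ) := by positivity
      linarith
    · have : b + 1 / (m : ℝ) - (a - 1 / m) = b - a + 2 / m := by ring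
      rw [this]; exact h2.le
  -- `τ` bounds the Fejér mass lost for widening `1 / m` and order `m ^ 4`. Dividing the smoothed
  -- indicator of `S` by `1 - τ` lifts it to at least `1` on the arc.
  set τ : ℝ := 1 / m ^ 2 with hτ
  have hτ4 : τ ≤ 1 / 4 := by
    rw [hτ]
    have : (4 : ℝ) ≤ m ^ 2 := by nlinarith
    gcongr
  have hτ0 : 0 < τ := by positivity
  have hτη : 1 / (1 / (m : ℝ)) ^ 2 / K = τ := by
    rw [hτ, hKr]; field_simp
  have hτm : τ ≤ 1 / m := by
    rw [hτ]
    gcongr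
    nlinarith
  set l : ℝ := (1 - τ)⁻¹ with hl
  have hl0 : 0 < l := by rw [hl]; exact inv_pos.2 (by linarith)
  have hl1 : l ≤ 1 + 2 * τ := by
    rw [hl, inv_le_iff_one_le_mul₀ (by linarith)]
    nlinarith
  set P := Finset.range K ×ˢ Finset.range K with hP
  -- Pairs are grouped by frequency. At most `K ^ 2` pairs of size `2 / K` give the crude
  -- coefficient bound `2 * K`, which is harmless against a power saving.
  set c : ℤ → ℂ := fun k => ∑ p ∈ P with (p.1 : ℤ) - p.2 = k,
    (l : ℂ) * ((K : ℂ)⁻¹ * ∫ t in S, fourier (-k) t) with hc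
  have hKC : (K : ℂ) ≠ 0 := by exact_mod_cast hK0.ne'
  refine ⟨c, fun k => ?_, ⟨l * volume.real S, ?_, by positivity, ?_⟩, fun x =>
    ⟨l * ∫ t in S, fejerKernel K (x - t), ?_, ?_⟩⟩
  · have hterm : ‖(l : ℂ) * ((K : ℂ)⁻¹ * ∫ t in S, fourier (-k) t)‖ ≤ 2 * (K : ℝ)⁻¹ := by
      rw [norm_mul, norm_mul, Complex.norm_real, Real.norm_of_nonneg hl0.le, norm_inv,
        Complex.norm_natCast]
      have := norm_setIntegral_fourier_le S (-k)
      calc l * ((K : ℝ)⁻¹ * ‖∫ t in S, fourier (-k) t‖) ≤ 2 * ((K : ℝ)⁻¹ * 1) := by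
            gcongr
            linarith
        _ = _ := by ring
    have hcard : ((P.filter fun p => (p.1 : ℤ) - p.2 = k).card : ℝ) ≤ K * K := by
      have := Finset.card_filter_le P fun p => (p.1 : ℤ) - p.2 = k
      rw [hP, Finset.card_product, Finset.card_range] at this
      exact_mod_cast this
    rw [hc]
    refine (norm_sum_le_of_le _ fun p _ => hterm).trans ?_
    rw [Finset.sum_const, nsmul_eq_mul, ← hKr]
    calc _ ≤ (K : ℝ) * K * (2 * (K : ℝ)⁻¹) := by gcongr
      _ = 2 * K := by field_simp
  · have hdiag : (P.filter fun p => (p.1 : ℤ) - p.2 = 0).card = K := by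
      have : (P.filter fun p => (p.1 : ℤ) - p.2 = 0) =
          (Finset.range K).map ⟨fun i => (i, i), fun i j h => (Prod.ext_iff.1 h).1⟩ := by
        ext ⟨i, j⟩
        simp only [hP, Finset.mem_filter, Finset.mem_product, Finset.mem_range, Finset.mem_map]
        constructor
        · rintro ⟨⟨hi, hj⟩, hij⟩
          exact ⟨i, hi, Prod.ext rfl (by show i = j; omega)⟩
        · rintro ⟨k, hk, h⟩
          obtain ⟨rfl, rfl⟩ := Prod.ext_iff.1 h
          exact ⟨⟨hk, hk⟩, sub_self _⟩
      rw [this, Finset.card_map, Finset.card_range]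
    rw [hc]
    simp only [Finset.sum_const, hdiag, nsmul_eq_mul, neg_zero, fourier_zero, integral_const,
      measureReal_restrict_apply_univ]
    push_cast
    field_simp
    simp
  · rw [hSvol, hvol]
    have hx1 : 0 < b - a + 2 / m := by
      have : 0 < 2 / (m : ℝ) := by positivity
      linarith
    have e1 : 2 / (m : ℝ) = 2 * (1 / m) := by ring
    have e2 : 6 / (m : ℝ) = 6 * (1 / m) := by ring
    nlinarith
  · have hmaps : ∀ p ∈ P, (p.1 : ℤ) - p.2 ∈ Finset.Icc (-K : ℤ) K := by
      intro p hp
      rw [hP, Finset.mem_product, Finset.mem_range, Finset.mem_range] at hp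
      rw [Finset.mem_Icc]
      omega
    push_cast
    rw [coe_setIntegral_fejerKernel_sub, Finset.mul_sum, ← Finset.sum_fiberwise_of_maps_to hmaps]
    refine Finset.sum_congr rfl fun k _ => ?_
    rw [hc, Finset.sum_mul]
    refine Finset.sum_congr rfl fun p hp => ?_
    rw [(Finset.mem_filter.1 hp).2]
    ring
  · by_cases hx : x ∈ circleArc a b
    · rw [Set.indicator_of_mem hx]
      have := one_sub_le_setIntegral_fejerKernel hK0 (η := 1 / m) (by positivity) hx
      rw [hτη, ← hS] at this
      calc (1 : ℝ) = l * (1 - τ) := by rw [hl, inv_mul_cancel₀ (by linarith)]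
        _ ≤ _ := by gcongr
    · rw [Set.indicator_of_notMem hx]
      have : 0 ≤ ∫ t in S, fejerKernel K (x - t) :=
        integral_nonneg fun t => fejerKernel_nonneg _ _
      positivity

/-! ### From Weyl sums to visits to boxes. -/

theorem prod_add_le_prod_add_pow {ι : Type*} (s : Finset ι) {v w : ι → ℝ} {η : ℝ} (hη : 0 ≤ η)
    (hv0 : ∀ i, 0 ≤ v i) (hv1 : ∀ i, v i ≤ 1) (hw0 : ∀ i, 0 ≤ w i) (hw : ∀ i, w i ≤ v i + η) :
    ∏ i ∈ s, w i ≤ ∏ i ∈ s, v i + ((1 + η) ^ s.card - 1) := by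
  classical
  induction s using Finset.induction_on with
  | empty => simp
  | insert i s hi ih =>
    rw [Finset.prod_insert hi, Finset.prod_insert hi, Finset.card_insert_of_notMem hi, pow_succ]
    have hP1 : ∏ j ∈ s, v j ≤ 1 := Finset.prod_le_one (fun j _ => hv0 j) fun j _ => hv1 j
    have hP0 : 0 ≤ ∏ j ∈ s, v j := Finset.prod_nonneg fun j _ => hv0 j
    have hE : 0 ≤ (1 + η) ^ s.card - 1 := sub_nonneg.2 (one_le_pow₀ (by linarith))
    have h1 : w i * ∏ j ∈ s, w j ≤ (v i + η) * (∏ j ∈ s, v j + ((1 + η) ^ s.card - 1)) :=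
      mul_le_mul (hw i) ih (Finset.prod_nonneg fun j _ => hw0 j) (by linarith [hv0 i])
    nlinarith [hv1 i]

theorem one_add_pow_sub_one_le {η : ℝ} (hη0 : 0 ≤ η) (hη1 : η ≤ 1) (d : ℕ) :
    (1 + η) ^ d - 1 ≤ (2 ^ d - 1) * η := by
  induction d with
  | zero => simp
  | succ d ih =>
    have h2 : (1 : ℝ) ≤ 2 ^ d := one_le_pow₀ one_le_two
    rw [pow_succ, pow_succ]
    nlinarith [mul_nonneg (sub_nonneg.2 h2) hη0]

theorem indicator_univ_pi_eq_prod {d : ℕ} (A : Fin d → Set UnitAddCircle) (x : Torus d) :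
    (Set.univ.pi A).indicator (fun _ => (1 : ℝ)) x =
      ∏ i, (A i).indicator (fun _ => (1 : ℝ)) (x i) := by
  by_cases hx : x ∈ Set.univ.pi A
  · rw [Set.indicator_of_mem hx]
    exact (Finset.prod_eq_one fun i _ => Set.indicator_of_mem (hx i trivial) _).symm
  · rw [Set.indicator_of_notMem hx]
    obtain ⟨i, hi⟩ : ∃ i, x i ∉ A i := by
      by_contra! h
      exact hx fun i _ => h i
    exact (Finset.prod_eq_zero (Finset.mem_univ i) (Set.indicator_of_notMem hi _)).symm

/-- Upper bound for the number of visits to a box whose sides have trigonometric majorants, in terms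
of the Weyl sums. -/
theorem sum_prod_indicator_le {d N K : ℕ} {B η ρ : ℝ} (hη : 0 ≤ η) (hB : 0 ≤ B) (hρ : 0 ≤ ρ)
    {A : Fin d → Set UnitAddCircle} (hA : ∀ i, HasTrigMajorant (A i) K B η) (x : ℕ → Torus d)
    (hx : ∀ k : Fin d → ℤ, k ≠ 0 → (∀ i, |k i| ≤ K) →
      ‖∑ n ∈ Finset.range N, ∏ i, fourier (k i) (x n i)‖ ≤ N * ρ) :
    ∑ n ∈ Finset.range N, ∏ i, (A i).indicator (fun _ => (1 : ℝ)) (x n i) ≤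
      N * (∏ i, volume.real (A i) + ((1 + η) ^ d - 1) + (2 * K + 1) ^ d * (B ^ d * ρ)) := by
  classical
  choose c hcB hc0 hg using hA
  choose v hcv hv0 hv using hc0
  choose g hgc hgA using hg
  set F := Fintype.piFinset fun _ : Fin d => Finset.Icc (-K : ℤ) K with hF
  have hFcard : (F.card : ℝ) = (2 * K + 1) ^ d := by
    rw [hF, Fintype.card_piFinset]
    simp only [Int.card_Icc, Finset.prod_const, Finset.card_univ, Fintype.card_fin]
    have : ((K : ℤ) + 1 - -K).toNat = 2 * K + 1 := by omega
    rw [this]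
    push_cast
    rfl
  have hF0 : (0 : Fin d → ℤ) ∈ F := by
    rw [hF, Fintype.mem_piFinset]
    intro i
    simp
  have hsum : ((∑ n ∈ Finset.range N, ∏ i, g i (x n i) : ℝ) : ℂ) =
      ∑ k ∈ F, (∏ i, c i (k i)) * ∑ n ∈ Finset.range N, ∏ i, fourier (k i) (x n i) := by
    push_cast
    simp_rw [← hgc, Finset.prod_univ_sum, Finset.prod_mul_distrib, Finset.mul_sum]
    rw [Finset.sum_comm]
  have hdiff : ‖((∑ n ∈ Finset.range N, ∏ i, g i (x n i) - N * ∏ i, v i : ℝ) : ℂ)‖ ≤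
      (2 * K + 1) ^ d * (B ^ d * (N * ρ)) := by
    -- The main term is the zero frequency; all others are controlled by the Weyl sums.
    have h0 : (N * ∏ i, (v i : ℂ)) = (∏ i, c i ((0 : Fin d → ℤ) i)) *
        ∑ n ∈ Finset.range N, ∏ i, fourier ((0 : Fin d → ℤ) i) (x n i) := by
      simp [hcv, mul_comm]
    rw [Complex.ofReal_sub, hsum]
    push_cast
    rw [h0, ← Finset.sum_erase_eq_sub hF0]
    have hterm : ∀ k ∈ F.erase 0, ‖(∏ i, c i (k i)) *
        ∑ n ∈ Finset.range N, ∏ i, fourier (k i) (x n i)‖ ≤ B ^ d * (N * ρ) := by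
      intro k hk
      rw [Finset.mem_erase, hF, Fintype.mem_piFinset] at hk
      rw [norm_mul, norm_prod]
      gcongr
      · calc ∏ i, ‖c i (k i)‖ ≤ ∏ _i : Fin d, B :=
              Finset.prod_le_prod (fun i _ => norm_nonneg _) fun i _ => hcB i _
          _ = B ^ d := by simp
      · exact hx k hk.1 fun i => abs_le.2 (Finset.mem_Icc.1 (hk.2 i))
    refine (norm_sum_le_of_le _ hterm).trans ?_
    rw [Finset.sum_const, nsmul_eq_mul, ← hFcard]
    gcongr
    exact Finset.erase_subset _ _
  rw [Complex.norm_real, Real.norm_eq_abs] at hdiff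
  have h1 : ∑ n ∈ Finset.range N, ∏ i, (A i).indicator (fun _ => (1 : ℝ)) (x n i) ≤
      ∑ n ∈ Finset.range N, ∏ i, g i (x n i) :=
    Finset.sum_le_sum fun n _ => Finset.prod_le_prod
      (fun i _ => Set.indicator_nonneg (fun _ _ => zero_le_one) _) fun i _ => hgA i _
  have h2 : ∏ i, v i ≤ ∏ i, volume.real (A i) + ((1 + η) ^ d - 1) := by
    have := prod_add_le_prod_add_pow Finset.univ (v := fun i => volume.real (A i)) hη
      (fun i => measureReal_nonneg) (fun i => ?_) hv0 hv
    · simpa using this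
    · refine (measureReal_mono (Set.subset_univ _)).trans (le_of_eq ?_)
      simp [measureReal_def]
  have h3 := (abs_le.1 hdiff).2
  have h4 : (N : ℝ) * ∏ i, v i ≤ N * (∏ i, volume.real (A i) + ((1 + η) ^ d - 1)) := by gcongr
  linarith

/-- Two-sided bound for the number of visits to a box, deduced from upper bounds for all boxes whose
sides are the given ones or their complements. -/
theorem abs_sum_prod_indicator_sub_le {d N : ℕ} {E : ℝ} (hE : 0 ≤ E)
    {A : Fin d → Set UnitAddCircle} (hA : ∀ i, MeasurableSet (A i)) (x : ℕ → Torus d)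
    (h : ∀ s : Fin d → Bool,
      ∑ n ∈ Finset.range N, ∏ i, (bif s i then A i else (A i)ᶜ).indicator (fun _ => (1 : ℝ))
        (x n i) ≤ N * (∏ i, volume.real (bif s i then A i else (A i)ᶜ) + E)) :
    |∑ n ∈ Finset.range N, ∏ i, (A i).indicator (fun _ => (1 : ℝ)) (x n i) -
      N * ∏ i, volume.real (A i)| ≤ N * (2 ^ d * E) := by
  classical
  set f : (Fin d → Bool) → ℝ := fun s => ∑ n ∈ Finset.range N,
    ∏ i, (bif s i then A i else (A i)ᶜ).indicator (fun _ => (1 : ℝ)) (x n i) with hf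
  set w : (Fin d → Bool) → ℝ := fun s => ∏ i, volume.real (bif s i then A i else (A i)ᶜ) with hw
  have hsf : ∑ s, f s = N := by
    rw [hf]
    beta_reduce
    rw [Finset.sum_comm]
    have : ∀ n ∈ Finset.range N, ∑ s : Fin d → Bool,
        ∏ i, (bif s i then A i else (A i)ᶜ).indicator (fun _ => (1 : ℝ)) (x n i) = 1 := by
      intro n _
      have := Finset.prod_univ_sum (fun _ : Fin d => (Finset.univ : Finset Bool))
        (fun i b => (bif b then A i else (A i)ᶜ).indicator (fun _ => (1 : ℝ)) (x n i))
      rw [Fintype.piFinset_univ] at this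
      rw [← this]
      refine Finset.prod_eq_one fun i _ => ?_
      rw [Fintype.sum_bool]
      by_cases hx : x n i ∈ A i <;> simp [hx]
    rw [Finset.sum_congr rfl this]
    simp
  have hsw : ∑ s, w s = 1 := by
    rw [hw]
    have := Finset.prod_univ_sum (fun _ : Fin d => (Finset.univ : Finset Bool))
      (fun i b => volume.real (bif b then A i else (A i)ᶜ))
    rw [Fintype.piFinset_univ] at this
    rw [← this]
    refine Finset.prod_eq_one fun i _ => ?_
    rw [Fintype.sum_bool]
    simp only [cond_true, cond_false]
    rw [measureReal_add_measureReal_compl (hA i)]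
    simp [measureReal_def]
  have h' : ∀ s, f s - N * w s ≤ N * E := fun s => by
    have := h s
    rw [mul_add] at this
    linarith
  -- The boxes partition the torus, so the excesses cancel in total, and the excess of one box is
  -- bounded below by minus the upper bounds for the others.
  have hsum : ∑ s, (f s - N * w s) = 0 := by
    rw [Finset.sum_sub_distrib, ← Finset.mul_sum, hsf, hsw]
    ring
  have hNE : 0 ≤ (N : ℝ) * E := by positivity
  have h2d : (1 : ℝ) ≤ 2 ^ d := one_le_pow₀ one_le_two
  have hmain : |f (fun _ => true) - N * w (fun _ => true)| ≤ N * (2 ^ d * E) := by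
    rw [abs_le]
    constructor
    · rw [← Finset.add_sum_erase _ _ (Finset.mem_univ (fun _ : Fin d => true))] at hsum
      have hle := Finset.sum_le_card_nsmul (Finset.univ.erase (fun _ : Fin d => true))
        (fun s => f s - N * w s) (N * E) fun s _ => h' s
      have hcard : ((Finset.univ.erase (fun _ : Fin d => true)).card : ℝ) ≤ 2 ^ d := by
        have := Finset.card_erase_le (s := Finset.univ) (a := fun _ : Fin d => true)
        simp only [Finset.card_univ, Fintype.card_pi, Fintype.card_bool, Finset.prod_const,
          Fintype.card_fin] at this
        exact_mod_cast this
      rw [nsmul_eq_mul] at hle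
      nlinarith
    · have := h' fun _ => true
      nlinarith
  simpa [hf, hw] using hmain

/-! ### Discrepancy of the skew-shift. -/

theorem prod_fourier_eq_toCircle {d : ℕ} (k : Fin d → ℤ) (x : Torus d) :
    ∏ i, fourier (k i) (x i) = (AddCircle.toCircle (∑ i, k i • x i) : ℂ) := by
  have : ∀ s : Finset (Fin d), ∏ i ∈ s, fourier (k i) (x i) =
      (AddCircle.toCircle (∑ i ∈ s, k i • x i) : ℂ) := by
    classical
    intro s
    induction s using Finset.induction_on with
    | empty => simp
    | insert i s hi ih =>
      rw [Finset.prod_insert hi, Finset.sum_insert hi, ih, UnitAddCircle.coe_toCircle_add,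
        fourier_apply]
  exact this _

theorem torusInterval_eq_univ_pi {d : ℕ} (β κ : Fin d → ℝ) :
    torusInterval β κ = Set.univ.pi fun i => circleArc (β i) (κ i) := by
  ext x
  simp [torusInterval, circleArc]

theorem discrepancy_le_of_forall {d N : ℕ} (hN : 0 < N) {ε : ℝ} (x : ℕ → Torus d)
    (h : ∀ β κ : Fin d → ℝ,
      |∑ n ∈ Finset.range N, ∏ i, (circleArc (β i) (κ i)).indicator (fun _ => (1 : ℝ)) (x n i) -
        N * ∏ i, volume.real (circleArc (β i) (κ i))| ≤ N * ε) :
    discrepancy (fun n : Fin N => x n) ≤ ε := by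
  have hN' : (0 : ℝ) < N := by exact_mod_cast hN
  have : Nonempty (torusIntervals d) := ⟨⟨_, 0, 0, rfl⟩⟩
  refine ciSup_le fun ⟨C, β, κ, hC⟩ => ?_
  subst hC
  have h1 : countIn (torusInterval β κ) (fun n : Fin N => x n) =
      ∑ n ∈ Finset.range N, ∏ i, (circleArc (β i) (κ i)).indicator (fun _ => (1 : ℝ)) (x n i) := by
    rw [countIn, Finset.sum_range, torusInterval_eq_univ_pi]
    simp_rw [indicator_univ_pi_eq_prod]
  have h2 : (volume (torusInterval β κ)).toReal = ∏ i, volume.real (circleArc (β i) (κ i)) := by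
    rw [torusInterval_eq_univ_pi, volume_pi_pi, ENNReal.toReal_prod]
    rfl
  simp only [h1, h2]
  have h3 := h β κ
  set X := ∑ n ∈ Finset.range N, ∏ i, (circleArc (β i) (κ i)).indicator (fun _ => (1 : ℝ)) (x n i)
  set Y := ∏ i, volume.real (circleArc (β i) (κ i))
  have : X / N - Y = (X - N * Y) / N := by field_simp
  rw [this, abs_div, abs_of_pos hN', div_le_iff₀ hN']
  linarith

theorem discrepancy_skewShift_le {d : ℕ} (hd : 1 ≤ d) {α : ℝ} {q : ℕ} (hq : 0 < q) {p : ℤ}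
    (hpq : IsCoprime p (q : ℤ)) (hα : |α - p / q| ≤ 1 / (q : ℝ) ^ 2) {m : ℕ} (hm : 6 ≤ m)
    (hmq : 4 * m ^ ((4 * d + 1) * 2 ^ d * (d + 1)) ≤ q) (y : Torus d) :
    discrepancy (fun n : Fin q => (skewShift d α)^[n.val] y) ≤ 11 * 12 ^ d / m := by
  have hm' : (6 : ℝ) ≤ m := by exact_mod_cast hm
  have hm0 : (0 : ℝ) < m := by linarith
  -- With degree `m ^ 4` and coefficients up to `2 * m ^ 4`, the nonzero frequencies cost at most `6
  -- ^ d * m ^ (8 * d)`. The saving is at least `L ^ 2 = m ^ (8 * d + 2)`.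
  set L := m ^ (4 * d + 1) with hL
  set H := L ^ 2 ^ d with hH
  have hL0 : 0 < L := by positivity
  have hL1 : (1 : ℝ) ≤ L := by exact_mod_cast hL0
  have hH0 : 0 < H := by positivity
  have hqH : 4 * H ^ (d + 1) ≤ q := by
    rw [hH, hL, ← pow_mul, ← pow_mul, ← mul_assoc]
    exact hmq
  have hKH : m ^ 4 ≤ H := by
    rw [hH, hL, ← pow_mul]
    refine Nat.pow_le_pow_right (by omega) ?_
    have : 1 ≤ 2 ^ d := Nat.one_le_two_pow
    nlinarith
  have hweyl : ∀ k : Fin d → ℤ, k ≠ 0 → (∀ i, |k i| ≤ (m ^ 4 : ℕ)) →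
      ‖∑ n ∈ Finset.range q, ∏ i, fourier (k i) ((skewShift d α)^[n] y i)‖ ≤
        q * (5 / (L : ℝ) ^ 2) := by
    intro k hk hkm
    obtain ⟨i, hi, hu⟩ := exists_isPolyPhase_sum_zsmul_skewShift α y hk
    simp_rw [prod_fourier_eq_toCircle]
    refine (hu.norm_sum_le hq hpq hα hd hL0 hH hqH i.isLt hi ?_).trans ?_
    · have h1 : |k i| ≤ H := (hkm i).trans (by exact_mod_cast hKH)
      calc |k i| * (H : ℤ) ^ i.val ≤ H * (H : ℤ) ^ i.val := by gcongr
        _ = (H : ℤ) ^ (i.val + 1) := by ring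
        _ ≤ (H : ℤ) ^ d := pow_le_pow_right₀ (by exact_mod_cast hH0) i.isLt
    · have h2 : (L : ℝ) ^ 2 ≤ (L : ℝ) ^ 2 ^ (d - i.val) := by
        refine pow_le_pow_right₀ hL1 ?_
        calc 2 = 2 ^ 1 := rfl
          _ ≤ 2 ^ (d - i.val) := Nat.pow_le_pow_right two_pos (by omega)
      calc 5 * (q / (L : ℝ) ^ 2 ^ (d - i.val)) ≤ 5 * (q / (L : ℝ) ^ 2) := by gcongr
        _ = _ := by ring
  set η : ℝ := 6 / m with hη
  have hη0 : 0 ≤ η := by positivity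
  have hη1 : η ≤ 1 := by
    rw [hη, div_le_one hm0]; exact hm'
  set E : ℝ := ((1 + η) ^ d - 1) +
    (2 * ((m ^ 4 : ℕ) : ℝ) + 1) ^ d * ((2 * (m : ℝ) ^ 4) ^ d * (5 / (L : ℝ) ^ 2)) with hE
  have hE0 : 0 ≤ E := by
    have : 0 ≤ (1 + η) ^ d - 1 := sub_nonneg.2 (one_le_pow₀ (by linarith))
    positivity
  have h6d : (2 : ℝ) ^ d ≤ 6 ^ d := pow_le_pow_left₀ (by norm_num) (by norm_num) d
  have hEle : E ≤ 11 * 6 ^ d / m := by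
    have h1 : (1 + η) ^ d - 1 ≤ 6 * 6 ^ d / m := by
      calc (1 + η) ^ d - 1 ≤ (2 ^ d - 1) * η := one_add_pow_sub_one_le hη0 hη1 d
        _ ≤ 6 ^ d * η := by gcongr; linarith
        _ = _ := by rw [hη]; ring
    have h2 : (2 * ((m ^ 4 : ℕ) : ℝ) + 1) ^ d * ((2 * (m : ℝ) ^ 4) ^ d * (5 / (L : ℝ) ^ 2)) ≤
        5 * 6 ^ d / m := by
      have h3 : 2 * ((m ^ 4 : ℕ) : ℝ) + 1 ≤ 3 * (m : ℝ) ^ 4 := by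
        push_cast
        have : (1 : ℝ) ≤ (m : ℝ) ^ 4 := one_le_pow₀ (by linarith)
        linarith
      have hLm : (L : ℝ) = (m : ℝ) ^ (4 * d + 1) := by rw [hL]; push_cast; rfl
      calc (2 * ((m ^ 4 : ℕ) : ℝ) + 1) ^ d * ((2 * (m : ℝ) ^ 4) ^ d * (5 / (L : ℝ) ^ 2))
          ≤ (3 * (m : ℝ) ^ 4) ^ d * ((2 * (m : ℝ) ^ 4) ^ d * (5 / (L : ℝ) ^ 2)) := by gcongr
        _ = 5 * 6 ^ d / (m : ℝ) ^ 2 := by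
          rw [hLm, ← mul_assoc, ← mul_pow,
            show 3 * (m : ℝ) ^ 4 * (2 * (m : ℝ) ^ 4) = 6 * (m : ℝ) ^ 8 by ring, mul_pow, ← pow_mul,
            ← pow_mul, show (4 * d + 1) * 2 = 8 * d + 2 by ring, pow_add]
          field_simp
        _ ≤ 5 * 6 ^ d / m := by
          gcongr
          nlinarith
    have : 11 * 6 ^ d / (m : ℝ) = 6 * 6 ^ d / m + 5 * 6 ^ d / m := by ring
    linarith
  refine (discrepancy_le_of_forall hq (ε := 2 ^ d * E) (fun n => (skewShift d α)^[n] y)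
    fun β κ => abs_sum_prod_indicator_sub_le hE0 (fun i => measurableSet_circleArc _ _) _
      fun s => ?_).trans ?_
  · rw [hE, ← add_assoc]
    refine sum_prod_indicator_le hη0 (by positivity) (by positivity) (fun i => ?_) _ hweyl
    rcases s i with _ | _
    · obtain ⟨a', b', hab⟩ := exists_compl_circleArc_eq (β i) (κ i)
      rw [cond_false, hab]
      exact hasTrigMajorant_circleArc _ _ (by omega)
    · exact hasTrigMajorant_circleArc _ _ (by omega)
  · calc (2 : ℝ) ^ d * E ≤ 2 ^ d * (11 * 6 ^ d / m) := by gcongr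
      _ = 11 * 12 ^ d / m := by
        rw [show (12 : ℝ) = 2 * 6 by norm_num, mul_pow]; ring

/-- Along large denominators of rational approximations of quality `1 / q ^ 2`, the discrepancy of
the orbits of the skew-shift has a power saving. -/
theorem exists_discrepancy_skewShift_le_rpow {d : ℕ} (hd : 1 ≤ d) :
    ∃ δ : ℝ, 0 < δ ∧ ∃ Q : ℕ, ∀ (α : ℝ) (q : ℕ) (p : ℤ), Q ≤ q → 0 < q → IsCoprime p (q : ℤ) →
      |α - p / q| ≤ 1 / (q : ℝ) ^ 2 → ∀ y : Torus d,
        discrepancy (fun n : Fin q => (skewShift d α)^[n.val] y) ≤ (q : ℝ) ^ (-δ) := by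
  set e := (4 * d + 1) * 2 ^ d * (d + 1) with he
  -- With `m = ⌊q ^ γ⌋₊`, the spare `1` in the exponent absorbs the factor `4` in `4 * m ^ e ≤ q`.
  -- The discrepancy is then `O(q ^ (-γ))`, and giving up half of the exponent absorbs the constant
  -- `22 * 12 ^ d`.
  set γ : ℝ := 1 / (e + 1) with hγ
  have hγ0 : 0 < γ := by positivity
  have htend := (tendsto_rpow_atTop (y := γ / 2) (by positivity)).comp
    (tendsto_natCast_atTop_atTop (R := ℝ))
  have htend' := (tendsto_rpow_atTop hγ0).comp (tendsto_natCast_atTop_atTop (R := ℝ))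
  obtain ⟨Q, hQ⟩ := Filter.eventually_atTop.1
    ((htend.eventually_ge_atTop (22 * 12 ^ d)).and (htend'.eventually_ge_atTop 7))
  refine ⟨γ / 2, by positivity, Q, fun α q p hQq hq hpq hα y => ?_⟩
  obtain ⟨hq1, hq2⟩ := hQ q hQq
  simp only [Function.comp_apply] at hq1 hq2
  have hq' : (0 : ℝ) < q := by exact_mod_cast hq
  set z := (q : ℝ) ^ γ with hz
  have hzq : z ^ (e + 1) = q := by
    rw [hz, ← Real.rpow_natCast, ← Real.rpow_mul hq'.le, hγ]
    push_cast
    rw [one_div_mul_cancel (by positivity), Real.rpow_one]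
  set m := ⌊z⌋₊ with hm
  have hm6 : 6 ≤ m := Nat.le_floor (by push_cast; linarith)
  have hmz : (m : ℝ) ≤ z := Nat.floor_le (by linarith)
  have hzm : z / 2 ≤ m := by
    have := Nat.lt_floor_add_one z
    linarith
  have hmq : 4 * m ^ e ≤ q := by
    have : 4 * (m : ℝ) ^ e ≤ q := by
      calc 4 * (m : ℝ) ^ e ≤ z * z ^ e := by
            gcongr
            linarith
        _ = q := by rw [← hzq]; ring
    exact_mod_cast this
  refine (discrepancy_skewShift_le hd hq hpq hα hm6 hmq y).trans ?_
  set t := (q : ℝ) ^ (γ / 2) with ht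
  have ht0 : 0 < t := Real.rpow_pos_of_pos hq' _
  have htz : z = t * t := by
    rw [hz, ht, ← Real.rpow_add hq']
    congr 1
    ring
  rw [Real.rpow_neg hq'.le, ← ht]
  calc 11 * 12 ^ d / (m : ℝ) ≤ 11 * 12 ^ d / (z / 2) := by gcongr
    _ = 22 * 12 ^ d / (t * t) := by rw [htz]; field_simp; norm_num
    _ ≤ t / (t * t) := by gcongr
    _ = t⁻¹ := by field_simp

theorem lemma3p6 (d : ℕ) (hd : 1 ≤ d) (α : ℝ) (hirr : Irrational α) (hα : α ∉ DC (d : ℝ)) :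
    ∃ δ : ℝ, 0 < δ ∧
      (∃ N k : ℕ → ℕ, StrictMono N ∧ StrictMono k ∧
        (∀ j, (N j : ℝ) = (GenContFract.of α).dens (k j)) ∧
        ∀ (j : ℕ) (y : Torus d),
          discrepancy (fun n : Fin (N j) => (skewShift d α)^[n.val + 1] y)
            ≤ (N j : ℝ) ^ (-δ)) ∧
      WeaklyBoundedDiscrepancy δ (skewShift d α) := by
  obtain ⟨δ, hδ, Q, hQ⟩ := exists_discrepancy_skewShift_le_rpow hd
  obtain ⟨q, hqmono, hq⟩ := GenContFract.exists_strictMono_dens hirr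
  -- Strict growth gives `q (j + Q) ≥ j + Q ≥ Q`, so dropping the first `Q` terms passes the
  -- threshold.
  have hmono : StrictMono fun j => q (j + Q) := fun i j hij => hqmono (by omega)
  have hdisc : ∀ (j : ℕ) (y : Torus d),
      discrepancy (fun n : Fin (q (j + Q)) => (skewShift d α)^[n.val] y)
        ≤ (q (j + Q) : ℝ) ^ (-δ) := by
    intro j y
    obtain ⟨-, hpos, p, hp, hle⟩ := hq (j + Q)
    exact hQ α _ p ((Nat.le_add_left Q j).trans (hqmono.le_apply)) hpos hp hle y
  -- The bound is uniform in the starting point, so the orbit segment beginning at time `1` is the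
  -- one of `skewShift d α y` beginning at time `0`.
  exact ⟨δ, hδ, ⟨fun j => q (j + Q), fun j => j + Q + 1, hmono, fun i j hij => by
    show i + Q + 1 < j + Q + 1
    omega, fun j => (hq _).1, fun j y => hdisc j (skewShift d α y)⟩, _, hmono, hdisc⟩
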